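/- **Setting.** Let $(X,d)$ be a compact metric space and $f_n:X\to X$ ($n\ge 0$) continuous maps that are equi-continuous in $X$: for every $\epsilon>0$ there is $\delta>0$ with $d(f_n(x),f_n(y))<\epsilon$ for all $n\ge0$ whenever $d(x,y)<\delta$. Write $f_n^0=\mathrm{id}$, $f_n^k=f_{n+k-1}\circ\cdots\circ f_n$ and $f_n^{-k}=(f_n^k)^{-1}$. Let $\mathcal K(X)$ be the set of nonempty compact subsets of $X$ with the Hausdorff metric, $\bar f_n(K)=f_n(K)$ for $K\in\mathcal K(X)$, $\bar f_{0,\infty}=\{\bar f_n\}_{n\ge0}$, and $\langle B\rangle=\{K\in\mathcal K(X):K\subset B\}$ for $B\subset X$. Let $A=(a_{ij})$ be an $N\times N$ transition matrix: $N\ge2$, all entries are $0$ or $1$, and every row sum and every column sum is at least $1$. Let $\Sigma_N^+(A)$ be the set of sequences $(s_0,s_1,\dots)$ in $\{1,\dots,N\}$ with $a_{s_js_{j+1}}=1$ for all $j$, with the metric $\hat\rho(\alpha,\beta)=\sum_{i\ge0}2^{-i}\hat d(a_i,b_i)$ for $\alpha=(a_i)$, $\beta=(b_i)$ ($\hat d$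 the discrete metric), let $\sigma_A$ be the shift map on it, and let $\rho(A)=\lim_{n\to\infty}\|A^n\|^{1/n}$, where $\|\cdot\|$ is the sum of the entries. Let $V_{i,n}$ ($1\le i\le N$, $n\ge0$) be nonempty closed subsets of $X$, and let $V_1,\dots,V_N$ be pairwise disjoint closed subsets of $X$ with $V_{i,n}\subset V_i$. For $\alpha=(a_0,a_1,\dots)\in\Sigma_N^+(A)$ put $V_\alpha^{m,n}=\bigcap_{k=0}^m f_n^{-k}(V_{a_k,n+k})$. Assume that (a) or (b) holds: (a) **(H$_1$)** $V_\alpha^{m,n}\ne\emptyset$ for all $m,n\ge0$ and $\alpha\in\Sigma_N^+(A)$; and **(H$_2$)** for every $\alpha\in\Sigma_N^+(A)$, $\operatorname{diam}V_\alpha^{m,n}\to0$ as $m\to\infty$, uniformly in $n\ge0$. (b) The system is weakly $A$-coupled-expanding, that is, $V_{i,n}\cap V_{j,n}=\partial V_{i,n}\cap\partial V_{j,n}$ for $i\ne j$, $n\ge 0$, and $f_n(V_{i,n})\supset\bigcup_{j:\,a_{ij}=1}V_{j,n+1}$ for all $i,n$; and there is $\lambda>1$ with $d(f_n(x),f_n(y))\ge\lambda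 d(x,y)$ for all $x,y\in V_{i,n}$, $1\le i\le N$, $n\ge0$. **Theorem 4.7 (case (a)) and Theorem 4.8 (case (b)).** There are nonempty compact sets $\mathcal C_n\subset\bigcup_{i=1}^N\langle V_{i,n}\rangle$ ($n\ge0$) with $\bar f_n(\mathcal C_n)=\mathcal C_{n+1}$ such that: 1. the system $\bar f_{0,\infty}$ restricted to $\{\mathcal C_n\}_{n\ge0}$ is topologically equi-conjugate to $(\Sigma_N^+(A),\sigma_A)$: there are bijections $h_n:\mathcal C_n\to\Sigma_N^+(A)$ with $h_{n+1}\circ\bar f_n=\sigma_A\circ h_n$ on $\mathcal C_n$ such that $\{h_n\}$ and $\{h_n^{-1}\}$ are both equi-continuous, with the modulus of continuity uniform in $n$ and in the points; 2. $h(\bar f_{0,\infty},\mathcal C_0)=\log\rho(A)$ (the limit defining $\rho(A)$ exists and is positive). Here $h(\bar f_{0,\infty},\mathcal C_0)=\sup_{\mathcal A}\limsup_{n\to\infty}\frac1n\log\mathcal N_n(\mathcal A)$, where $\mathcal A$ ranges over the open covers of $\mathcal K(X)$ and $\mathcal N_n(\mathcal A)$ is the least number of sets of the form $\bigcap_{j=0}^{n-1}\bar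 f_0^{-j}(A_j)$, $A_j\in\mathcal A$, that cover $\mathcal C_0$. Moreover, if $A$ is irreducible (for all $i,j$ there is $k\ge1$ with $(A^k)_{ij}>0$) and $\sum_{j}a_{i_0j}\ge2$ for some $i_0$, then, with $\mathcal H_d$ the Hausdorff metric: 3. $\bar f_{0,\infty}$ is chaotic in the strong sense of Li–Yorke: there are $\delta>0$ and an uncountable set $S\subset\mathcal K(X)$ such that every point of $S$ has a bounded orbit and, for all distinct $K,L\in S$, $\liminf_{n\to\infty}\mathcal H_d(\bar f_0^n(K),\bar f_0^n(L))=0$ and $\limsup_{n\to\infty}\mathcal H_d(\bar f_0^n(K),\bar f_0^n(L))>\delta$; 4. $\bar f_{0,\infty}$ is distributionally chaotic: there is an uncountable set $D\subset\mathcal K(X)$ such that for all distinct $K,L\in D$, writing $F_n(\epsilon)=\frac1n\#\{0\le i<n:\mathcal H_d(\bar f_0^i(K),\bar f_0^i(L))<\epsilon\}$, one has $\limsup_{n\to\infty} F_n(\epsilon)=1$ for every $\epsilon>0$ and $\liminf_{n\to\infty} F_n(\delta)=0$ for some $\delta>0$. -/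

import Mathlib

open Set Filter Topology
open scoped ENNReal

namespace NDS

noncomputable section

/-! ### Non-autonomous discrete systems `x (n+1) = f n (x n)` -/

/-- `iter f i k = f (i+k-1) ∘ ⋯ ∘ f i`, with `iter f i 0 = id`. -/
def iter {X : Type*} (f : ℕ → X → X) (i : ℕ) : ℕ → X → X
  | 0 => id
  | k + 1 => f (i + k) ∘ iter f i k

section Chaos

variable {X : Type*} [PseudoMetricSpace X]

/-- Distinct points of `S` are proximal, but not `δ`-asymptotic. The limits are taken
in `[0,∞]`, where they always exist. -/
def IsLiYorkeScrambled (f : ℕ → X → X) (δ : ℝ) (S : Set X) : Prop :=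
  ∀ x ∈ S, ∀ y ∈ S, x ≠ y →
    liminf (fun n => edist (iter f 0 n x) (iter f 0 n y)) atTop = 0 ∧
    ENNReal.ofReal δ < limsup (fun n => edist (iter f 0 n x) (iter f 0 n y)) atTop

/-- Chaos in the strong sense of Li–Yorke: for some `δ > 0` there is an uncountable
`δ`-scrambled set all of whose points have bounded orbits. -/
def IsStronglyLiYorkeChaotic (f : ℕ → X → X) : Prop :=
  ∃ δ : ℝ, 0 < δ ∧ ∃ S : Set X, ¬ S.Countable ∧ IsLiYorkeScrambled f δ S ∧
    ∀ x ∈ S, Bornology.IsBounded (range fun n => iter f 0 n x)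

/-- The proportion of times `i < n` at which the orbits of `x` and `y` are `ε`-close. -/
def closeFreq (f : ℕ → X → X) (ε : ℝ) (x y : X) (n : ℕ) : ℝ :=
  (1 / (n : ℝ)) *
    ∑ i ∈ Finset.range n, (Ico 0 ε).indicator 1 (dist (iter f 0 i x) (iter f 0 i y))

/-- Distributional chaos: there is an uncountable distributionally scrambled set. -/
def IsDistributionallyChaotic (f : ℕ → X → X) : Prop :=
  ∃ D : Set X, ¬ D.Countable ∧ ∀ x ∈ D, ∀ y ∈ D, x ≠ y →
    (∀ ε : ℝ, 0 < ε → limsup (closeFreq f ε x y) atTop = 1) ∧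
    ∃ δ : ℝ, 0 < δ ∧ liminf (closeFreq f δ x y) atTop = 0

end Chaos

/-! ### Topological entropy -/

section Entropy

variable {X : Type*}

/-- The least cardinality of a subfamily of `𝒰` that covers `Y` (equivalently, of a subcover
of the cover `{U ∩ Y : U ∈ 𝒰}` of `Y`). -/
def minSubcover (𝒰 : Set (Set X)) (Y : Set X) : ℕ∞ :=
  ⨅ (s : Set (Set X)) (_ : s ⊆ 𝒰) (_ : Y ⊆ ⋃₀ s), s.encard

/-- The family of all `⋂_{j<n} f_0^{-j}(c j)` with `c j ∈ 𝒜`. -/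
def joinCover (f : ℕ → X → X) (𝒜 : Set (Set X)) (n : ℕ) : Set (Set X) :=
  {W | ∃ c : ℕ → Set X, (∀ j < n, c j ∈ 𝒜) ∧ W = ⋂ j, ⋂ (_ : j < n), iter f 0 j ⁻¹' c j}

/-- Topological entropy of the non-autonomous system `f` on the subset `Y` (`X` compact),
through open covers of `X`. -/
def entropy [TopologicalSpace X] (f : ℕ → X → X) (Y : Set X) : EReal :=
  ⨆ (𝒜 : Set (Set X)) (_ : ∀ U ∈ 𝒜, IsOpen U) (_ : ⋃₀ 𝒜 = univ),
    limsup (fun n : ℕ => ENNReal.log (minSubcover (joinCover f 𝒜 n) Y : ℝ≥0∞) / (n : EReal)) atTop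

end Entropy

/-! ### Equi-conjugacy of invariant subsystems -/

section Conjugacy

variable {X Y : Type*} [PseudoMetricSpace X] [PseudoMetricSpace Y]

/-- Equi-continuity of a sequence of maps `h n : Λ n → E n`. -/
def EquiCont {Λ : ℕ → Set X} {E : ℕ → Set Y} (h : ∀ n, Λ n → E n) : Prop :=
  ∀ ε : ℝ, 0 < ε → ∃ δ : ℝ, 0 < δ ∧
    ∀ n, ∀ x y : Λ n, dist x y < δ → dist (h n x) (h n y) < ε

/-- `Λ` and `E` are invariant under `f` and `g`, and the invariant subsystems are
topologically equi-conjugate. -/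
def IsEquiConjugate (f : ℕ → X → X) (Λ : ℕ → Set X) (g : ℕ → Y → Y) (E : ℕ → Set Y) : Prop :=
  ∃ (hΛ : ∀ n, MapsTo (f n) (Λ n) (Λ (n + 1))) (hE : ∀ n, MapsTo (g n) (E n) (E (n + 1)))
    (h : ∀ n, Λ n ≃ E n),
    EquiCont (fun n => ⇑(h n)) ∧ EquiCont (fun n => ⇑(h n).symm) ∧
    ∀ n, h (n + 1) ∘ (hΛ n).restrict = (hE n).restrict ∘ h n

end Conjugacy

/-! ### Transition matrices and subshifts of finite type -/

structure IsTransitionMatrix {N : ℕ} (A : Matrix (Fin N) (Fin N) ℕ) : Prop where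
  two_le : 2 ≤ N
  zero_or_one : ∀ i j, A i j = 0 ∨ A i j = 1
  row : ∀ i, 1 ≤ ∑ j, A i j
  col : ∀ j, 1 ≤ ∑ i, A i j

def IsIrreducible {N : ℕ} (A : Matrix (Fin N) (Fin N) ℕ) : Prop :=
  ∀ i j, ∃ k : ℕ, 0 < k ∧ 0 < (A ^ k) i j

/-- `‖A ^ n‖ ^ (1 / n)`, where `‖·‖` is the sum of the entries. -/
def growth {N : ℕ} (A : Matrix (Fin N) (Fin N) ℕ) (n : ℕ) : ℝ :=
  ((∑ i, ∑ j, (A ^ n) i j : ℕ) : ℝ) ^ (1 / (n : ℝ))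

/-- `ρ(A) = lim ‖A ^ n‖ ^ (1 / n)`. -/
def rho {N : ℕ} (A : Matrix (Fin N) (Fin N) ℕ) : ℝ := limUnder atTop (growth A)

/-- The space `Σ_N^+(A)` of one-sided `A`-admissible sequences. -/
def Subshift {N : ℕ} (A : Matrix (Fin N) (Fin N) ℕ) : Type :=
  {s : ℕ → Fin N // ∀ j, A (s j) (s (j + 1)) = 1}

namespace Subshift

variable {N : ℕ} {A : Matrix (Fin N) (Fin N) ℕ}

/-- The shift map `σ_A`. -/
def shift (s : Subshift A) : Subshift A := ⟨fun j => s.1 (j + 1), fun j => s.2 (j + 1)⟩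

/-- The `i`-th summand of the metric. -/
def term (s t : Subshift A) (i : ℕ) : ℝ := (if s.1 i = t.1 i then 0 else 1) / 2 ^ i

lemma term_nonneg (s t : Subshift A) (i : ℕ) : 0 ≤ term s t i := by
  unfold term; split_ifs <;> positivity

lemma summable_term (s t : Subshift A) : Summable (term s t) := by
  refine Summable.of_nonneg_of_le (term_nonneg s t) (fun i => ?_) summable_geometric_two
  unfold term
  split_ifs
  · simp
  · simp

/-- The metric `∑ d̂(s i, t i) / 2 ^ i`, where `d̂` is the discrete metric. -/
instance : MetricSpace (Subshift A) where
  dist s t := ∑' i, term s t i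
  dist_self s := by simp [term]
  dist_comm s t := by
    refine tsum_congr fun i => ?_
    simp [term, eq_comm]
  dist_triangle s t u := by
    rw [← (summable_term s t).tsum_add (summable_term t u)]
    refine (summable_term s u).tsum_le_tsum (fun i => ?_)
      ((summable_term s t).add (summable_term t u))
    unfold term
    rw [← add_div]
    gcongr
    split_ifs <;> simp_all
  eq_of_dist_eq_zero {s t} h := by
    refine Subtype.ext (funext fun i => ?_)
    have h0 := (hasSum_zero_iff_of_nonneg (term_nonneg s t)).1
      (by have := (summable_term s t).hasSum; rwa [show ∑' i, term s t i = 0 from h] at this)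
    have hi := congrFun h0 i
    by_contra hne
    simp [term, hne] at hi

end Subshift

/-! ### Itineraries and coupled expansion -/

section Expansion

variable {X : Type*} {N : ℕ}

/-- `V_α^{m,n} = ⋂_{k=0}^m f_n^{-k}(V_{a_k,n+k})`. -/
def cyl {A : Matrix (Fin N) (Fin N) ℕ} (f : ℕ → X → X) (V : Fin N → ℕ → Set X)
    (α : Subshift A) (m n : ℕ) : Set X :=
  ⋂ k, ⋂ (_ : k ≤ m), iter f n k ⁻¹' V (α.1 k) (n + k)

/-- Nonemptiness of all the sets `V_α^{m,n}`. -/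
def HypNonempty (A : Matrix (Fin N) (Fin N) ℕ) (f : ℕ → X → X) (V : Fin N → ℕ → Set X) : Prop :=
  ∀ (α : Subshift A) (m n : ℕ), (cyl f V α m n).Nonempty

/-- For every `α`, the diameter of `V_α^{m,n}` tends to `0` as `m → ∞`, uniformly in `n`. -/
def HypShrinking [PseudoMetricSpace X] (A : Matrix (Fin N) (Fin N) ℕ) (f : ℕ → X → X)
    (V : Fin N → ℕ → Set X) : Prop :=
  ∀ α : Subshift A,
    TendstoUniformly (fun m n => Metric.diam (cyl f V α m n)) (fun _ => 0) atTop

/-- Weak `A`-coupled-expansion in the sequences `n ↦ V i n`. -/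
def IsWeaklyCoupledExpanding [TopologicalSpace X] (A : Matrix (Fin N) (Fin N) ℕ) (f : ℕ → X → X)
    (V : Fin N → ℕ → Set X) : Prop :=
  (∀ i n, (V i n).Nonempty) ∧
  (∀ i j, i ≠ j → ∀ n, V i n ∩ V j n = frontier (V i n) ∩ frontier (V j n)) ∧
  ∀ i n, (⋃ j, ⋃ (_ : A i j = 1), V j (n + 1)) ⊆ f n '' V i n

/-- Expansion on each `V i n` by a common factor `c > 1`. -/
def IsUniformlyExpanding [PseudoMetricSpace X] (f : ℕ → X → X) (V : Fin N → ℕ → Set X) : Prop :=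
  ∃ c : ℝ, 1 < c ∧ ∀ i n, ∀ x ∈ V i n, ∀ y ∈ V i n, c * dist x y ≤ dist (f n x) (f n y)

end Expansion

/-! ### The induced set-valued system
The space of nonempty compact subsets, with the Hausdorff metric, is
`TopologicalSpace.NonemptyCompacts X`. -/

section Induced

open TopologicalSpace

variable {X : Type*} [TopologicalSpace X]

/-- The induced maps `K ↦ f n (K)`. -/
def induced (f : ℕ → X → X) (hf : ∀ n, Continuous (f n)) (n : ℕ) :
    NonemptyCompacts X → NonemptyCompacts X :=
  NonemptyCompacts.map (f n) (hf n)

/-- `⟨K⟩`, the family of nonempty compact subsets of `X` contained in `K`. -/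
def hyper (K : Set X) : Set (NonemptyCompacts X) := {L | (L : Set X) ⊆ K}

end Induced

end

end NDS

/-! Case (b) reduces to case (a): the covering relation makes every cylinder nonempty by pulling
points back, and expansion by `c > 1` bounds the distances in a cylinder of depth `m` by `diam X / c
^ m`. In case (a) nested compact cylinders with diameters tending to `0` single out one point `g n
α` for each code `α` and time `n`. The set at time `n` consists of the singletons `{g n α}`: since
`x ↦ {x}` is an isometry that commutes with the maps, the hyperspace inherits whatever holds for
these points.

All conclusions follow from `IsCoding`: the shift corresponds to the dynamics, and closeness of
points amounts, uniformly in `n`, to agreement of long initial words. Equi-conjugacy is a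
reformulation of this. For entropy, the minimal covers are compared with the numbers of words of
length `n` and `n + m`; words are counted by powers of `A` (`card_lang_succ`), and Fekete's lemma
gives the growth rate. For chaos, irreducibility and branching give two loops that can be
concatenated freely; a binary sequence decides which loop to follow on time blocks so long that each
outweighs all the time before it (`exists_alternating_family`). -/

namespace NDS

/-! ### Symbolic dynamics: metric, compactness, word counts and loops. -/

namespace Subshift

variable {N : ℕ} {A : Matrix (Fin N) (Fin N) ℕ}

@[ext] lemma ext {α β : Subshift A} (h : ∀ k, α.1 k = β.1 k) : α = β :=
  Subtype.ext (funext h)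

lemma iterate_shift_apply (k : ℕ) (α : Subshift A) (j : ℕ) :
    (shift^[k] α).1 j = α.1 (k + j) := by
  induction k generalizing α with
  | zero => simp
  | succ k ih =>
    rw [Function.iterate_succ_apply, ih]
    exact congrArg α.1 (by omega : k + j + 1 = k + 1 + j)

/-- Prepend a symbol. -/
def cons (i : Fin N) (α : Subshift A) (h : A i (α.1 0) = 1) : Subshift A :=
  ⟨fun k => Nat.casesOn k i α.1, fun j => by cases j with
    | zero => exact h
    | succ j => exact α.2 j⟩

@[simp] lemma cons_zero (i : Fin N) (α : Subshift A) (h : A i (α.1 0) = 1) :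
    (cons i α h).1 0 = i := rfl

@[simp] lemma cons_succ (i : Fin N) (α : Subshift A) (h : A i (α.1 0) = 1) (k : ℕ) :
    (cons i α h).1 (k + 1) = α.1 k := rfl

lemma shift_surjective (hA : IsTransitionMatrix A) :
    Function.Surjective (shift : Subshift A → Subshift A) := by
  intro α
  obtain ⟨i, -, hi⟩ := Finset.exists_ne_zero_of_sum_ne_zero
    (Nat.one_le_iff_ne_zero.1 (hA.col (α.1 0)))
  exact ⟨cons i α ((hA.zero_or_one _ _).resolve_left hi), rfl⟩

lemma exists_apply_zero_eq (hA : IsTransitionMatrix A) (i : Fin N) :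
    ∃ α : Subshift A, α.1 0 = i := by
  have h : ∀ i, ∃ j, A i j = 1 := fun i => by
    obtain ⟨j, -, hj⟩ := Finset.exists_ne_zero_of_sum_ne_zero
      (Nat.one_le_iff_ne_zero.1 (hA.row i))
    exact ⟨j, (hA.zero_or_one _ _).resolve_left hj⟩
  choose next hnext using h
  refine ⟨⟨fun k => next^[k] i, fun k => ?_⟩, rfl⟩
  simp only [Function.iterate_succ_apply']
  exact hnext _

lemma nonempty (hA : IsTransitionMatrix A) : Nonempty (Subshift A) :=
  (exists_apply_zero_eq hA ⟨0, lt_of_lt_of_le two_pos hA.two_le⟩).nonempty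

/-! ### The metric -/

lemma eq_of_dist_lt {α β : Subshift A} {m : ℕ} (h : dist α β < 1 / 2 ^ m) {k : ℕ} (hk : k ≤ m) :
    α.1 k = β.1 k := by
  by_contra hne
  have h1 : term α β k ≤ dist α β :=
    (summable_term α β).le_tsum k fun i _ => term_nonneg α β i
  have h2 : term α β k = 1 / 2 ^ k := by simp [term, hne]
  have h3 : (1 : ℝ) / 2 ^ m ≤ 1 / 2 ^ k :=
    one_div_le_one_div_of_le (by positivity) (pow_le_pow_right₀ one_le_two hk)
  linarith

lemma dist_le_of_eq {α β : Subshift A} {m : ℕ} (h : ∀ k < m, α.1 k = β.1 k) :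
    dist α β ≤ 2 * (1 / 2) ^ m := by
  have h1 : dist α β = ∑' i, term α β (i + m) := by
    have := (summable_term α β).sum_add_tsum_nat_add m
    rw [Finset.sum_eq_zero, zero_add] at this
    · exact this.symm
    · intro k hk
      simp [term, h k (Finset.mem_range.1 hk)]
  have h2 : Summable fun i : ℕ => (1 / 2 : ℝ) ^ i * (1 / 2) ^ m :=
    summable_geometric_two.mul_right _
  have h3 : ∑' i : ℕ, (1 / 2 : ℝ) ^ i * (1 / 2) ^ m = 2 * (1 / 2) ^ m := by
    rw [tsum_mul_right, tsum_geometric_two]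
  rw [h1, ← h3]
  refine ((summable_nat_add_iff m).2 (summable_term α β)).tsum_le_tsum (fun i => ?_) h2
  rw [← pow_add, one_div_pow]
  unfold term
  gcongr
  split_ifs <;> norm_num

/-! ### Compactness -/

/-- Compactness is stated in the product topology, where it is Tychonoff plus a closed condition;
later arguments only need neighbourhoods given by finitely many letters. -/
lemma isCompact_admissible (A : Matrix (Fin N) (Fin N) ℕ) :
    IsCompact {s : ℕ → Fin N | ∀ j, A (s j) (s (j + 1)) = 1} := by
  apply IsClosed.isCompact
  simp only [ofPred_forall]
  refine isClosed_iInter fun j => ?_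
  have : Continuous fun s : ℕ → Fin N => A (s j) (s (j + 1)) :=
    (continuous_of_discreteTopology (f := fun q : Fin N × Fin N => A q.1 q.2)).comp
      (by fun_prop : Continuous fun s : ℕ → Fin N => (s j, s (j + 1)))
  exact isClosed_eq this continuous_const

lemma eventually_eq_of_lt (s : ℕ → Fin N) (m : ℕ) : ∀ᶠ t in 𝓝 s, ∀ k < m, t k = s k := by
  have : ∀ k, ∀ᶠ t in 𝓝 s, t k = s k := fun k =>
    (continuous_apply k).continuousAt.eventually_mem
      (by rw [nhds_discrete]; exact mem_pure.2 rfl : {s k} ∈ 𝓝 (s k))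
  exact (Filter.eventually_all_finite (Set.finite_lt_nat m)).2 fun k _ => this k

/-! ### Words -/

open Classical in
/-- The words of length `n` that occur as initial words of admissible sequences. -/
noncomputable def lang (A : Matrix (Fin N) (Fin N) ℕ) (n : ℕ) : Finset (Fin n → Fin N) :=
  Finset.univ.filter fun w => ∃ α : Subshift A, ∀ i : Fin n, α.1 i = w i

lemma mem_lang {n : ℕ} {w : Fin n → Fin N} :
    w ∈ lang A n ↔ ∃ α : Subshift A, ∀ i : Fin n, α.1 i = w i := by
  simp [lang]

lemma initial_mem_lang (α : Subshift A) (n : ℕ) : (fun i : Fin n => α.1 i) ∈ lang A n :=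
  mem_lang.2 ⟨α, fun _ => rfl⟩

lemma one_le_card_lang (hA : IsTransitionMatrix A) (n : ℕ) : 1 ≤ (lang A n).card := by
  obtain ⟨α⟩ := nonempty hA
  exact Finset.card_pos.2 ⟨_, initial_mem_lang α n⟩

/-- Cutting a word after `m` letters is injective, and the second part is an initial word of the
shifted sequence. -/
lemma card_lang_add_le (m n : ℕ) :
    (lang A (m + n)).card ≤ (lang A m).card * (lang A n).card := by
  rw [← Finset.card_product]
  refine Finset.card_le_card_of_injOn
    (fun w => (fun i => w (Fin.castAdd n i), fun i => w (Fin.natAdd m i))) ?_ ?_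
  · intro w hw
    obtain ⟨α, hα⟩ := mem_lang.1 hw
    refine Finset.mem_coe.2 (Finset.mem_product.2 ⟨mem_lang.2 ⟨α, fun i => hα (Fin.castAdd n i)⟩,
      mem_lang.2 ⟨shift^[m] α, fun i => ?_⟩⟩)
    rw [iterate_shift_apply]
    exact hα (Fin.natAdd m i)
  · intro w _ w' _ h
    obtain ⟨h1, h2⟩ := Prod.mk.inj h
    funext i
    refine Fin.addCases (fun i => ?_) (fun i => ?_) i
    · exact congrFun h1 i
    · exact congrFun h2 i

lemma card_lang_filter (hA : IsTransitionMatrix A) (n : ℕ) (i : Fin N) :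
    ((lang A (n + 1)).filter fun w => w 0 = i).card = ∑ j, (A ^ n) i j := by
  induction n generalizing i with
  | zero =>
    obtain ⟨α, hα⟩ := exists_apply_zero_eq hA i
    rw [Finset.card_eq_one.2]
    · simp [Matrix.one_apply]
    · refine ⟨fun _ => i, Finset.eq_singleton_iff_unique_mem.2 ⟨?_, ?_⟩⟩
      · refine Finset.mem_filter.2 ⟨mem_lang.2 ⟨α, fun k => ?_⟩, rfl⟩
        have hk : (k : ℕ) = 0 := by omega
        rw [hk]
        exact hα
      · intro w hw
        funext k
        have hk : k = 0 := Fin.ext (by omega)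
        rw [hk]
        exact (Finset.mem_filter.1 hw).2
  | succ n ih =>
    classical
    -- A word starting at `i` is `i` followed by a word starting at a successor `j` of `i`, which
    -- mirrors `A ^ (n + 1) = A * A ^ n`.
    have hU : (lang A (n + 1 + 1)).filter (fun w => w 0 = i) =
        (Finset.univ.filter fun j => A i j = 1).biUnion fun j =>
          ((lang A (n + 1)).filter fun w => w 0 = j).image
            fun w => (Fin.cons i w : Fin (n + 1 + 1) → Fin N) := by
      ext w
      simp only [Finset.mem_filter, Finset.mem_biUnion, Finset.mem_image, Finset.mem_univ,
        true_and]
      constructor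
      · rintro ⟨hw, hi⟩
        obtain ⟨α, hα⟩ := mem_lang.1 hw
        have h0 : α.1 0 = i := (hα 0).trans hi
        refine ⟨α.1 1, h0 ▸ α.2 0, Fin.tail w, ⟨mem_lang.2 ⟨shift α, fun k => hα k.succ⟩,
          (hα 1).symm⟩, ?_⟩
        rw [← hi, Fin.cons_self_tail]
      · rintro ⟨j, hj, w', ⟨hw', h0⟩, rfl⟩
        obtain ⟨α, hα⟩ := mem_lang.1 hw'
        have hα0 : α.1 0 = j := (hα 0).trans h0
        refine ⟨mem_lang.2 ⟨cons i α (by rw [hα0]; exact hj), fun k => ?_⟩, rfl⟩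
        refine Fin.cases rfl (fun k => ?_) k
        simpa using hα k
    rw [hU, Finset.card_biUnion]
    · simp_rw [Finset.card_image_of_injective _
        (Fin.cons_right_injective (α := fun _ : Fin (n + 1 + 1) => Fin N) i), ih]
      rw [Finset.sum_filter]
      simp_rw [pow_succ' A n, Matrix.mul_apply]
      rw [Finset.sum_comm]
      refine Finset.sum_congr rfl fun j _ => ?_
      rw [← Finset.mul_sum]
      rcases hA.zero_or_one i j with h | h <;> simp [h]
    · intro j _ j' _ hjj
      refine Finset.disjoint_left.2 ?_
      intro w hw hw'
      simp only [Finset.mem_image, Finset.mem_filter] at hw hw'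
      obtain ⟨u, ⟨-, hu⟩, rfl⟩ := hw
      obtain ⟨v, ⟨-, hv⟩, h⟩ := hw'
      apply hjj
      rw [← hu, ← hv,
        Fin.cons_right_injective (α := fun _ : Fin (n + 1 + 1) => Fin N) i h]

lemma card_lang_succ (hA : IsTransitionMatrix A) (n : ℕ) :
    (lang A (n + 1)).card = ∑ i, ∑ j, (A ^ n) i j := by
  rw [Finset.card_eq_sum_card_fiberwise (f := fun w => w 0) (t := Finset.univ) (by simp)]
  exact Finset.sum_congr rfl fun i _ => card_lang_filter hA n i

lemma subadditive_log_card_lang (hA : IsTransitionMatrix A) :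
    Subadditive fun n => Real.log (lang A n).card := by
  intro m n
  have hm : ((lang A m).card : ℝ) ≠ 0 := Nat.cast_ne_zero.2 (Nat.one_le_iff_ne_zero.1 (one_le_card_lang hA m))
  have hn : ((lang A n).card : ℝ) ≠ 0 := Nat.cast_ne_zero.2 (Nat.one_le_iff_ne_zero.1 (one_le_card_lang hA n))
  rw [← Real.log_mul hm hn]
  refine Real.log_le_log (by exact_mod_cast one_le_card_lang hA (m + n)) ?_
  exact_mod_cast card_lang_add_le m n

lemma tendsto_log_card_lang_div (hA : IsTransitionMatrix A) :
    Tendsto (fun n : ℕ => Real.log (lang A n).card / n) atTop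
      (𝓝 (subadditive_log_card_lang hA).lim) := by
  refine (subadditive_log_card_lang hA).tendsto_lim ⟨0, ?_⟩
  rintro _ ⟨n, rfl⟩
  exact div_nonneg (Real.log_natCast_nonneg _) n.cast_nonneg

/-- Bounded shifts of the length do not matter, as `(n + m) / n → 1`. The case `m = 1` serves
`growth`, general `m` the upper bound for entropy. -/
lemma tendsto_log_card_lang_add_div (hA : IsTransitionMatrix A) (m : ℕ) :
    Tendsto (fun n : ℕ => Real.log (lang A (n + m)).card / n) atTop
      (𝓝 (subadditive_log_card_lang hA).lim) := by
  have h1 := (tendsto_add_atTop_iff_nat m).2 (tendsto_log_card_lang_div hA)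
  have h2 : Tendsto (fun n : ℕ => ((n : ℝ) + m) / n) atTop (𝓝 1) := by
    have : Tendsto (fun n : ℕ => 1 + (m : ℝ) / n) atTop (𝓝 (1 + 0)) :=
      tendsto_const_nhds.add (tendsto_const_div_atTop_nhds_zero_nat _)
    rw [add_zero] at this
    refine this.congr' ?_
    filter_upwards [eventually_gt_atTop 0] with n hn
    have : (n : ℝ) ≠ 0 := by exact_mod_cast hn.ne'
    field_simp
  have h3 := h1.mul h2
  rw [mul_one] at h3
  refine h3.congr' ?_
  filter_upwards [eventually_gt_atTop 0] with n hn
  have : (n : ℝ) ≠ 0 := by exact_mod_cast hn.ne'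
  have : (n : ℝ) + m ≠ 0 := by positivity
  push_cast
  field_simp

lemma tendsto_growth_exp (hA : IsTransitionMatrix A) :
    Tendsto (growth A) atTop (𝓝 (Real.exp (subadditive_log_card_lang hA).lim)) := by
  refine ((Real.continuous_exp.tendsto _).comp (tendsto_log_card_lang_add_div hA 1)).congr ?_
  intro n
  have : (0 : ℝ) < (lang A (n + 1)).card := by exact_mod_cast one_le_card_lang hA (n + 1)
  simp only [Function.comp_apply, growth]
  rw [← card_lang_succ hA, Real.rpow_def_of_pos this, mul_one_div]

lemma rho_eq_exp (hA : IsTransitionMatrix A) :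
    rho A = Real.exp (subadditive_log_card_lang hA).lim :=
  (tendsto_growth_exp hA).limUnder_eq

lemma tendsto_growth (hA : IsTransitionMatrix A) : Tendsto (growth A) atTop (𝓝 (rho A)) :=
  rho_eq_exp hA ▸ tendsto_growth_exp hA

lemma rho_pos (hA : IsTransitionMatrix A) : 0 < rho A :=
  rho_eq_exp hA ▸ Real.exp_pos _

lemma tendsto_log_card_lang_add_div_log_rho (hA : IsTransitionMatrix A) (m : ℕ) :
    Tendsto (fun n : ℕ => Real.log (lang A (n + m)).card / n) atTop (𝓝 (Real.log (rho A))) := by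
  rw [rho_eq_exp hA, Real.log_exp]
  exact tendsto_log_card_lang_add_div hA m

/-! ### Free concatenation of two loops -/

lemma exists_path (hA : IsTransitionMatrix A) (k : ℕ) :
    ∀ i j, 0 < (A ^ k) i j →
      ∃ w : ℕ → Fin N, w 0 = i ∧ w k = j ∧ ∀ r < k, A (w r) (w (r + 1)) = 1 := by
  induction k with
  | zero =>
    intro i j h
    have : i = j := by
      by_contra hij
      simp [hij] at h
    exact ⟨fun _ => i, rfl, this, by simp⟩
  | succ k ih =>
    intro i j h
    rw [pow_succ', Matrix.mul_apply] at h
    obtain ⟨l, -, hl⟩ := Finset.exists_ne_zero_of_sum_ne_zero h.ne'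
    obtain ⟨h1, h2⟩ := mul_ne_zero_iff.1 hl
    obtain ⟨w, hw0, hwk, hw⟩ := ih l j (Nat.pos_of_ne_zero h2)
    refine ⟨fun r => Nat.casesOn r i w, rfl, hwk, fun r hr => ?_⟩
    cases r with
    | zero =>
      change A i (w 0) = 1
      rw [hw0]
      exact (hA.zero_or_one _ _).resolve_left h1
    | succ r => exact hw r (by omega)

/-- The edge from `i` to `j` is closed up by a path from `j` back to `i`, and the resulting loop is
repeated. -/
lemma exists_periodic (hA : IsTransitionMatrix A) (hirr : IsIrreducible A) {i j : Fin N}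
    (hij : A i j = 1) :
    ∃ (p : ℕ) (u : Subshift A), 0 < p ∧ Function.Periodic u.1 p ∧ u.1 0 = i ∧ u.1 1 = j := by
  obtain ⟨k, hk, hpos⟩ := hirr j i
  obtain ⟨w, hw0, hwk, hw⟩ := exists_path hA k j i hpos
  let w' : ℕ → Fin N := fun r => Nat.casesOn r i w
  have hw' : ∀ r < k + 1, A (w' r) (w' (r + 1)) = 1 := by
    intro r hr
    cases r with
    | zero =>
      change A i (w 0) = 1
      rwa [hw0]
    | succ r => exact hw r (by omega)
  refine ⟨k + 1, ⟨fun r => w' (r % (k + 1)), fun r => ?_⟩, k.succ_pos, fun r => ?_, ?_, ?_⟩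
  · have hlt : r % (k + 1) < k + 1 := Nat.mod_lt r k.succ_pos
    change A (w' (r % (k + 1))) (w' ((r + 1) % (k + 1))) = 1
    have h := hw' _ hlt
    by_cases hr : r % (k + 1) = k
    · have : (r + 1) % (k + 1) = 0 := by
        rw [Nat.add_mod, hr]
        rcases k with _ | k <;> simp
      rw [this]
      rw [hr] at h ⊢
      have hi : w' (k + 1) = w' 0 := hwk
      rwa [hi] at h
    · have : (r + 1) % (k + 1) = r % (k + 1) + 1 := by
        rw [Nat.add_mod, Nat.mod_eq_of_lt (a := 1) (by omega), Nat.mod_eq_of_lt]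
        omega
      rwa [this]
  · simp
  · simp [w']
  · change w' (1 % (k + 1)) = j
    rw [Nat.mod_eq_of_lt (by omega)]
    exact hw0

lemma exists_loops (hA : IsTransitionMatrix A) (hirr : IsIrreducible A)
    (hbr : ∃ i₀, 2 ≤ ∑ j, A i₀ j) :
    ∃ (p : ℕ) (u v : Subshift A), 0 < p ∧ (∀ k, u.1 (p * k) = v.1 (p * k)) ∧
      ∀ k, u.1 (p * k + 1) ≠ v.1 (p * k + 1) := by
  obtain ⟨i, hi⟩ := hbr
  have : ∃ j j', j ≠ j' ∧ A i j = 1 ∧ A i j' = 1 := by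
    have hcard : ∑ j, A i j = (Finset.univ.filter fun j => A i j = 1).card := by
      rw [Finset.card_filter]
      refine Finset.sum_congr rfl fun j _ => ?_
      rcases hA.zero_or_one i j with h | h <;> simp [h]
    rw [hcard] at hi
    obtain ⟨j, hj, j', hj', hne⟩ := Finset.one_lt_card.1 hi
    exact ⟨j, j', hne, (Finset.mem_filter.1 hj).2, (Finset.mem_filter.1 hj').2⟩
  obtain ⟨j, j', hne, hj, hj'⟩ := this
  obtain ⟨p, u, hp, hup, hu0, hu1⟩ := exists_periodic hA hirr hj
  obtain ⟨q, v, hq, hvq, hv0, hv1⟩ := exists_periodic hA hirr hj'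
  have hu : ∀ k r, u.1 (p * q * k + r) = u.1 r := fun k r => by
    have := hup.nat_mul (q * k) r
    rwa [Nat.cast_id, show r + q * k * p = p * q * k + r by ring] at this
  have hv : ∀ k r, v.1 (p * q * k + r) = v.1 r := fun k r => by
    have := hvq.nat_mul (p * k) r
    rwa [Nat.cast_id, show r + p * k * q = p * q * k + r by ring] at this
  -- A common period of both loops: both are back at `i` at its multiples and leave it along
  -- different edges.
  refine ⟨p * q, u, v, Nat.mul_pos hp hq, fun k => ?_, fun k => ?_⟩
  · have h1 := hu k 0
    have h2 := hv k 0
    rw [add_zero] at h1 h2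
    rw [h1, h2, hu0, hv0]
  · rw [hu, hv, hu1, hv1]
    exact hne

/-- The sequence that follows `u` on the `k`-th block of length `p` if `b k`, and `v` otherwise. -/
def weave (p : ℕ) (u v : Subshift A) (h : ∀ k, u.1 (p * k) = v.1 (p * k)) (b : ℕ → Bool) :
    Subshift A :=
  ⟨fun i => if b (i / p) then u.1 i else v.1 i, fun i => by
    -- The choice can change only when `i + 1` is a multiple of `p`, and there `u` and `v` carry the
    -- same letter.
    by_cases hd : p ∣ i + 1
    · obtain ⟨k, hk⟩ := hd
      have := h k
      rw [← hk] at this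
      have hu := u.2 i
      have hv := v.2 i
      simp only [this, ite_self] at hu ⊢
      split_ifs <;> assumption
    · simp only [Nat.succ_div_of_not_dvd hd]
      split_ifs
      · exact u.2 i
      · exact v.2 i⟩

end Subshift

end NDS

/-! ### Codings: equi-conjugacy and entropy. -/

namespace NDS

section General

variable {X : Type*}

lemma exists_ball_subset_mem_cover [PseudoMetricSpace X] [CompactSpace X] {𝒜 : Set (Set X)}
    (ho : ∀ U ∈ 𝒜, IsOpen U) (hc : ⋃₀ 𝒜 = univ) :
    ∃ ε > 0, ∀ x, ∃ U ∈ 𝒜, Metric.ball x ε ⊆ U := by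
  obtain ⟨ε, hε, h⟩ := lebesgue_number_lemma_of_metric_sUnion isCompact_univ ho hc.ge
  exact ⟨ε, hε, fun x => h x (mem_univ x)⟩

/-- Positivity of `a` excludes `log 0 = ⊥`; at `n = 0` both sides are `0` by the convention for
division. -/
lemma log_natCast_div (a n : ℕ) (ha : 0 < a) :
    ENNReal.log (((a : ℕ∞)) : ℝ≥0∞) / (n : EReal) = ((Real.log a / n : ℝ) : EReal) := by
  rw [ENat.toENNReal_coe, ENNReal.log_pos_real (by exact_mod_cast ha.ne') (by simp),
    EReal.coe_div]
  simp

end General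

variable {N : ℕ} {A : Matrix (Fin N) (Fin N) ℕ} {Z : Type*} [PseudoMetricSpace Z]

/-- The maps `φ n` code points of `Z` by admissible sequences: they intertwine the shift with
`F`, and the distance of coded points is small, uniformly in `n`, precisely when long initial
words of their codes agree. -/
structure IsCoding (F : ℕ → Z → Z) (φ : ℕ → Subshift A → Z) : Prop where
  semiconj : ∀ n α, F n (φ n α) = φ (n + 1) α.shift
  close : ∀ ε : ℝ, 0 < ε → ∃ m : ℕ, ∀ n α β, (∀ k < m, α.1 k = β.1 k) →
    dist (φ n α) (φ n β) < ε
  separated : ∀ m : ℕ, ∃ δ : ℝ, 0 < δ ∧ ∀ n α β, dist (φ n α) (φ n β) < δ →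
    ∀ k < m, α.1 k = β.1 k

namespace IsCoding

variable {F : ℕ → Z → Z} {φ : ℕ → Subshift A → Z}

lemma iter_apply (h : IsCoding F φ) (n k : ℕ) (α : Subshift A) :
    iter F n k (φ n α) = φ (n + k) (Subshift.shift^[k] α) := by
  induction k with
  | zero => rfl
  | succ k ih =>
    change F (n + k) (iter F n k (φ n α)) = _
    rw [ih, h.semiconj, Function.iterate_succ_apply']
    rfl

lemma injective (h : IsCoding F φ) (n : ℕ) : Function.Injective (φ n) := by
  intro α β hαβ
  refine Subshift.ext fun k => ?_
  obtain ⟨δ, hδ, hsep⟩ := h.separated (k + 1)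
  exact hsep n α β (by rwa [hαβ, dist_self]) k k.lt_succ_self

lemma image_range (h : IsCoding F φ) (hA : IsTransitionMatrix A) (n : ℕ) :
    F n '' range (φ n) = range (φ (n + 1)) := by
  rw [← range_comp]
  ext z
  constructor
  · rintro ⟨α, rfl⟩
    exact ⟨α.shift, (h.semiconj n α).symm⟩
  · rintro ⟨α, rfl⟩
    obtain ⟨β, rfl⟩ := Subshift.shift_surjective hA α
    exact ⟨β, h.semiconj n β⟩

lemma isCompact_range (h : IsCoding F φ) (n : ℕ) : IsCompact (range (φ n)) := by
  have hK := isCompact_iff_compactSpace.1 (Subshift.isCompact_admissible A)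
  let ψ : {s : ℕ → Fin N | ∀ j, A (s j) (s (j + 1)) = 1} → Z := fun s => φ n ⟨s.1, s.2⟩
  have hψ : Continuous ψ := by
    rw [continuous_iff_continuousAt]
    intro s
    rw [ContinuousAt, Metric.tendsto_nhds]
    intro ε hε
    obtain ⟨m, hm⟩ := h.close ε hε
    have := continuous_subtype_val.continuousAt.eventually
      (Subshift.eventually_eq_of_lt s.1 m)
    filter_upwards [this] with t ht
    exact hm n _ _ ht
  have : range (φ n) = range ψ := by
    ext z
    exact ⟨fun ⟨α, hα⟩ => ⟨⟨α.1, α.2⟩, hα⟩, fun ⟨s, hs⟩ => ⟨⟨s.1, s.2⟩, hs⟩⟩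
  rw [this]
  exact _root_.isCompact_range hψ

lemma isEquiConjugate (h : IsCoding F φ) :
    IsEquiConjugate F (fun n => range (φ n))
      (fun _ => (Subshift.shift : Subshift A → Subshift A)) (fun _ => univ) := by
  let e : ∀ n, range (φ n) ≃ (univ : Set (Subshift A)) := fun n =>
    (Equiv.ofInjective (φ n) (h.injective n)).symm.trans (Equiv.Set.univ _).symm
  have he : ∀ n (α : (univ : Set (Subshift A))), ((e n).symm α : Z) = φ n α := fun n α => rfl
  have he' : ∀ n x, φ n (e n x) = x := fun n x => by
    rw [← he, Equiv.symm_apply_apply]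
  refine ⟨fun n => ?_, fun n => mapsTo_univ _ _, e, ?_, ?_, ?_⟩
  · rintro _ ⟨α, rfl⟩
    exact ⟨α.shift, (h.semiconj n α).symm⟩
  · intro ε hε
    obtain ⟨m, hm⟩ := exists_pow_lt_of_lt_one (half_pos hε) one_half_lt_one
    obtain ⟨δ, hδ, hsep⟩ := h.separated m
    refine ⟨δ, hδ, fun n x y hxy => ?_⟩
    rw [Subtype.dist_eq, ← he' n x, ← he' n y] at hxy
    have := Subshift.dist_le_of_eq (hsep n _ _ hxy)
    rw [Subtype.dist_eq]
    linarith
  · intro ε hε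
    obtain ⟨m, hm⟩ := h.close ε hε
    refine ⟨1 / 2 ^ m, by positivity, fun n x y hxy => ?_⟩
    rw [Subtype.dist_eq, he, he]
    exact hm n _ _ fun k hk => Subshift.eq_of_dist_lt hxy hk.le
  · intro n
    funext x
    refine Subtype.ext (h.injective (n + 1) ?_)
    simp only [Function.comp_apply, he', MapsTo.val_restrict_apply]
    rw [← h.semiconj, he']
    rfl

/-- With `ε` a Lebesgue number and `m` letters enough for `ε`-closeness, codes sharing `n + m`
letters stay `ε`-close at the times `j < n`. Hence one cell around a representative orbit suffices
per word. -/
lemma minSubcover_le [CompactSpace Z] (h : IsCoding F φ) (hA : IsTransitionMatrix A) {𝒜 : Set (Set Z)}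
    (ho : ∀ U ∈ 𝒜, IsOpen U) (hc : ⋃₀ 𝒜 = univ) :
    ∃ m : ℕ, ∀ n, minSubcover (joinCover F 𝒜 n) (range (φ 0)) ≤
      (Subshift.lang A (n + m)).card := by
  have := Subshift.nonempty hA
  obtain ⟨ε, hε, hball⟩ := exists_ball_subset_mem_cover ho hc
  choose U hU hUball using hball
  obtain ⟨m, hm⟩ := h.close ε hε
  refine ⟨m, fun n => ?_⟩
  choose! rep hrep using fun (w : Fin (n + m) → Fin N) (hw : w ∈ Subshift.lang A (n + m)) =>
    Subshift.mem_lang.1 hw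
  let cell : (Fin (n + m) → Fin N) → Set Z := fun w =>
    ⋂ j, ⋂ (_ : j < n), iter F 0 j ⁻¹' U (φ j (Subshift.shift^[j] (rep w)))
  refine (iInf₂_le (cell '' (Subshift.lang A (n + m) : Set (Fin (n + m) → Fin N))) ?_).trans
    ((iInf_le _ ?_).trans ?_)
  · rintro _ ⟨w, -, rfl⟩
    exact ⟨fun j => U (φ j (Subshift.shift^[j] (rep w))), fun j _ => hU _, rfl⟩
  · rintro _ ⟨α, rfl⟩
    have hα := Subshift.initial_mem_lang α (n + m)
    refine ⟨_, mem_image_of_mem _ (Finset.mem_coe.2 hα), ?_⟩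
    simp only [cell, mem_iInter, mem_preimage]
    intro j hj
    apply hUball
    rw [h.iter_apply, zero_add, Metric.mem_ball]
    refine hm j _ _ fun k hk => ?_
    rw [Subshift.iterate_shift_apply, Subshift.iterate_shift_apply]
    exact (hrep _ hα ⟨j + k, by omega⟩).symm
  · exact (encard_image_le _ _).trans (encard_coe_eq_coe_finsetCard _).le

/-- Balls of radius `δ / 2` have points less than `δ` apart, so they determine the first letter of
the code. A cell of the join then determines `n` letters, and different words need different cells.
-/
lemma exists_le_minSubcover (h : IsCoding F φ) (hA : IsTransitionMatrix A) :
    ∃ 𝒜 : Set (Set Z), (∀ U ∈ 𝒜, IsOpen U) ∧ ⋃₀ 𝒜 = univ ∧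
      ∀ n, ((Subshift.lang A n).card : ℕ∞) ≤ minSubcover (joinCover F 𝒜 n) (range (φ 0)) := by
  have := Subshift.nonempty hA
  obtain ⟨δ, hδ, hsep⟩ := h.separated 1
  refine ⟨range fun x => Metric.ball x (δ / 2), ?_, ?_, fun n => ?_⟩
  · rintro _ ⟨x, rfl⟩
    exact Metric.isOpen_ball
  · exact eq_univ_of_forall fun x => ⟨_, ⟨x, rfl⟩, Metric.mem_ball_self (half_pos hδ)⟩
  refine le_iInf₂ fun s hs => le_iInf fun hcov => ?_
  have hmem : ∀ w ∈ Subshift.lang A n, ∃ (α : Subshift A) (T : Set Z), (∀ i : Fin n, α.1 i = w i) ∧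
      T ∈ s ∧ φ 0 α ∈ T := by
    intro w hw
    obtain ⟨α, hα⟩ := Subshift.mem_lang.1 hw
    obtain ⟨T, hT, hαT⟩ := hcov (mem_range_self α)
    exact ⟨α, T, hα, hT, hαT⟩
  choose! rep cell hrep hcell hmem using hmem
  rw [← encard_coe_eq_coe_finsetCard]
  refine encard_le_encard_of_injOn (f := cell) (fun w hw => hcell w hw) ?_
  intro w hw w' hw' heq
  obtain ⟨c, hc, hT⟩ := hs (hcell w hw)
  have h1 := hmem w hw
  have h2 := hmem w' hw'
  rw [← heq] at h2
  rw [hT] at h1 h2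
  simp only [mem_iInter, mem_preimage, h.iter_apply, zero_add] at h1 h2
  funext i
  obtain ⟨x, hx⟩ := hc i i.2
  have h1 := h1 i i.2
  have h2 := h2 i i.2
  rw [← hx, Metric.mem_ball] at h1 h2
  have hd : dist (φ i (Subshift.shift^[i] (rep w))) (φ i (Subshift.shift^[i] (rep w'))) < δ :=
    (dist_triangle_right _ _ x).trans_lt (by linarith)
  have := hsep _ _ _ hd 0 one_pos
  rwa [Subshift.iterate_shift_apply, Subshift.iterate_shift_apply, add_zero, hrep w hw,
    hrep w' hw'] at this

lemma entropy_eq [CompactSpace Z] (h : IsCoding F φ) (hA : IsTransitionMatrix A) :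
    entropy F (range (φ 0)) = (Real.log (rho A) : EReal) := by
  have hlim : ∀ m, limsup (fun n : ℕ => ENNReal.log
      ((((Subshift.lang A (n + m)).card : ℕ∞)) : ℝ≥0∞) / (n : EReal)) atTop =
      (Real.log (rho A) : EReal) := fun m => by
    simp_rw [log_natCast_div _ _ (Subshift.one_le_card_lang hA _)]
    exact (EReal.tendsto_coe.2 (Subshift.tendsto_log_card_lang_add_div_log_rho hA m)).limsup_eq
  have hmono : ∀ (a b : ℕ∞) (n : ℕ), a ≤ b →
      ENNReal.log (a : ℝ≥0∞) / (n : EReal) ≤ ENNReal.log (b : ℝ≥0∞) / (n : EReal) :=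
    fun a b n hab => EReal.div_le_div_right_of_nonneg (Nat.cast_nonneg' n)
      (ENNReal.log_monotone (ENat.toENNReal_le.2 hab))
  apply le_antisymm
  · refine iSup_le fun 𝒜 => iSup_le fun ho => iSup_le fun hc => ?_
    obtain ⟨m, hm⟩ := h.minSubcover_le hA ho hc
    rw [← hlim m]
    exact limsup_le_limsup (Eventually.of_forall fun n => hmono _ _ n (hm n))
  · obtain ⟨𝒜, ho, hc, hle⟩ := h.exists_le_minSubcover hA
    refine le_trans ?_ (le_iSup_of_le 𝒜 (le_iSup_of_le ho (le_iSup_of_le hc le_rfl)))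
    rw [← hlim 0]
    exact limsup_le_limsup (Eventually.of_forall fun n => hmono _ _ n (hle n))

end IsCoding

end NDS

/-! ### Li–Yorke and distributional chaos of coded systems. -/

namespace NDS

/-! ### Long blocks of times -/

/-- The times from `p * 2 ^ 2 ^ n` to `p * 2 ^ 2 ^ (n + 1)`, without the last `M` of them. -/
def block (p M n : ℕ) : Set ℕ := {i | p * 2 ^ 2 ^ n ≤ i ∧ i + M < p * 2 ^ 2 ^ (n + 1)}

lemma le_two_pow_two_pow (n : ℕ) : n ≤ 2 ^ 2 ^ n :=
  (Nat.lt_two_pow_self (n := n)).le.trans Nat.lt_two_pow_self.le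

/-- The end of a block is, up to the factor `p`, the square of its start, so the time before a block
is a vanishing proportion. -/
lemma two_pow_two_pow_succ (n : ℕ) : 2 ^ 2 ^ (n + 1) = 2 ^ 2 ^ n * 2 ^ 2 ^ n := by
  rw [pow_succ 2 n, mul_two, pow_add]

lemma mem_block_of_lt {p M n : ℕ} (hp : 0 < p) (hn : M < n) : p * 2 ^ 2 ^ n ∈ block p M n := by
  have h1 := le_two_pow_two_pow n
  have h2 : 2 * 2 ^ 2 ^ n ≤ 2 ^ 2 ^ (n + 1) := by
    rw [two_pow_two_pow_succ]
    exact Nat.mul_le_mul_right _ (Nat.le_self_pow (by positivity) 2)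
  refine ⟨le_rfl, lt_of_lt_of_le ?_ (Nat.mul_le_mul_left p h2)⟩
  nlinarith

/-- Dropping the last `M` times lets a code be read up to `M` letters ahead without leaving the
range where `selector` is constant. -/
lemma div_mem_of_mem_block {p M n i j : ℕ} (hp : 0 < p) (hi : i ∈ block p M n) (hij : i ≤ j)
    (hj : j ≤ i + M) : 2 ^ 2 ^ n ≤ j / p ∧ j / p < 2 ^ 2 ^ (n + 1) :=
  ⟨(Nat.le_div_iff_mul_le hp).2 (by rw [mul_comm]; exact hi.1.trans hij),
    (Nat.div_lt_iff_lt_mul hp).2 (by rw [mul_comm]; exact hj.trans_lt hi.2)⟩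

lemma frequently_of_block {p M : ℕ} (hp : 0 < p) {P : ℕ → Prop}
    (h : ∃ᶠ n in atTop, ∀ i ∈ block p M n, P i) : ∃ᶠ i in atTop, P i := by
  have ht : Tendsto (fun n : ℕ => p * 2 ^ 2 ^ n) atTop atTop :=
    tendsto_atTop_mono (fun n => (le_two_pow_two_pow n).trans (Nat.le_mul_of_pos_left _ hp))
      tendsto_id
  refine ht.frequently ((h.and_eventually (eventually_gt_atTop M)).mono fun n hn => ?_)
  exact hn.1 _ (mem_block_of_lt hp hn.2)

/-- The proportion of times before the end of the block that do not belong to it. -/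
lemma tendsto_block_ratio {p : ℕ} (hp : 0 < p) (M : ℕ) :
    Tendsto (fun n : ℕ => ((p * 2 ^ 2 ^ n + M : ℕ) : ℝ) / (p * 2 ^ 2 ^ (n + 1) : ℕ)) atTop
      (𝓝 0) := by
  refine squeeze_zero' (Eventually.of_forall fun n => by positivity) ?_
    (tendsto_const_div_atTop_nhds_zero_nat ((M : ℝ) + 1))
  filter_upwards [eventually_gt_atTop 0] with n hn
  rw [div_le_div_iff₀ (by positivity) (by exact_mod_cast hn)]
  norm_cast
  rw [two_pow_two_pow_succ]
  have h1 := le_two_pow_two_pow n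
  generalize 2 ^ 2 ^ n = T at h1
  calc (p * T + M) * n ≤ (p * T + M * (p * T)) * T := by
        gcongr
        exact Nat.le_mul_of_pos_right _ (Nat.mul_pos hp (hn.trans_le h1))
    _ = (M + 1) * (p * (T * T)) := by ring

section Frequency

variable {X : Type*} [PseudoMetricSpace X] {f : ℕ → X → X} {ε : ℝ} {x y : X}

lemma indicator_Ico_le_one (t : ℝ) : (Ico 0 ε).indicator (1 : ℝ → ℝ) t ≤ 1 :=
  indicator_le_self' (fun _ _ => zero_le_one) t

lemma indicator_Ico_nonneg (t : ℝ) : 0 ≤ (Ico 0 ε).indicator (1 : ℝ → ℝ) t :=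
  indicator_nonneg (fun _ _ => zero_le_one) t

lemma closeFreq_nonneg (n : ℕ) : 0 ≤ closeFreq f ε x y n :=
  mul_nonneg (by positivity) (Finset.sum_nonneg fun _ _ => indicator_Ico_nonneg _)

lemma closeFreq_le_one (n : ℕ) : closeFreq f ε x y n ≤ 1 := by
  unfold closeFreq
  rw [one_div_mul_eq_div]
  refine div_le_one_of_le₀ ?_ n.cast_nonneg
  refine (Finset.sum_le_sum fun _ _ => indicator_Ico_le_one _).trans ?_
  simp

lemma one_sub_le_closeFreq {a b M : ℕ} (hb : 0 < b)
    (h : ∀ i, a ≤ i → i + M < b → dist (iter f 0 i x) (iter f 0 i y) < ε) :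
    1 - ((a + M : ℕ) : ℝ) / b ≤ closeFreq f ε x y b := by
  have hb' : (0 : ℝ) < b := by exact_mod_cast hb
  unfold closeFreq
  rw [one_div_mul_eq_div, le_div_iff₀ hb', sub_mul, div_mul_cancel₀ _ hb'.ne', one_mul]
  have hsub : Finset.Ico a (b - M) ⊆ Finset.range b := fun i hi => by
    simp only [Finset.mem_Ico, Finset.mem_range] at hi ⊢
    omega
  refine le_trans ?_ (Finset.sum_le_sum_of_subset_of_nonneg hsub
    fun _ _ _ => indicator_Ico_nonneg _)
  rw [Finset.sum_congr rfl (g := fun _ => (1 : ℝ))]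
  · have : b ≤ (b - M - a) + (a + M) := by omega
    have : (b : ℝ) ≤ (b - M - a : ℕ) + (a + M : ℕ) := by exact_mod_cast this
    simp only [Finset.sum_const, Nat.card_Ico, nsmul_eq_mul, mul_one]
    linarith
  · intro i hi
    rw [Finset.mem_Ico] at hi
    exact indicator_of_mem (mem_Ico.2 ⟨dist_nonneg, h i hi.1 (by omega)⟩) _

lemma closeFreq_le {a b M : ℕ} (hb : 0 < b)
    (h : ∀ i, a ≤ i → i + M < b → ε ≤ dist (iter f 0 i x) (iter f 0 i y)) :
    closeFreq f ε x y b ≤ ((a + M : ℕ) : ℝ) / b := by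
  unfold closeFreq
  rw [one_div_mul_eq_div]
  gcongr
  have hsub : Finset.Ico a (b - M) ⊆ Finset.range b := fun i hi => by
    simp only [Finset.mem_Ico, Finset.mem_range] at hi ⊢
    omega
  rw [← Finset.sum_sdiff hsub, Finset.sum_eq_zero (s := Finset.Ico a (b - M)), add_zero]
  · refine (Finset.sum_le_sum fun _ _ => indicator_Ico_le_one _).trans ?_
    rw [Finset.sum_const, Finset.card_sdiff_of_subset hsub, Finset.card_range, Nat.card_Ico,
      nsmul_eq_mul, mul_one, Nat.cast_le]
    omega
  · intro i hi
    rw [Finset.mem_Ico] at hi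
    exact indicator_of_notMem (fun hm => (h i hi.1 (by omega)).not_gt hm.2) _

lemma tendsto_block_end {p : ℕ} (hp : 0 < p) :
    Tendsto (fun n : ℕ => p * 2 ^ 2 ^ (n + 1)) atTop atTop :=
  tendsto_atTop_mono (fun n => n.le_succ.trans
    ((le_two_pow_two_pow (n + 1)).trans (Nat.le_mul_of_pos_left _ hp))) tendsto_id

lemma limsup_closeFreq_eq_one {p M : ℕ} (hp : 0 < p) (h : ∃ᶠ n in atTop, ∀ i ∈ block p M n,
      dist (iter f 0 i x) (iter f 0 i y) < ε) :
    limsup (closeFreq f ε x y) atTop = 1 := by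
  have hbdd : IsBoundedUnder (· ≤ ·) atTop (closeFreq f ε x y) :=
    isBoundedUnder_of ⟨1, closeFreq_le_one⟩
  have hbdd' : IsBoundedUnder (· ≥ ·) atTop (closeFreq f ε x y) :=
    isBoundedUnder_of ⟨0, closeFreq_nonneg⟩
  apply le_antisymm
  · exact limsup_le_of_le hbdd'.isCoboundedUnder_le (Eventually.of_forall closeFreq_le_one)
  · refine le_of_forall_sub_le fun η hη => ?_
    refine le_limsup_of_frequently_le ((tendsto_block_end hp).frequently ?_) hbdd
    refine (h.and_eventually ((tendsto_block_ratio hp M).eventually_lt_const hη)).mono ?_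
    rintro n ⟨hn, hlt⟩
    refine le_trans ?_ (one_sub_le_closeFreq (by positivity) fun i h1 h2 => hn i ⟨h1, h2⟩)
    linarith

lemma liminf_closeFreq_eq_zero {p M : ℕ} (hp : 0 < p) (h : ∃ᶠ n in atTop, ∀ i ∈ block p M n,
      ε ≤ dist (iter f 0 i x) (iter f 0 i y)) :
    liminf (closeFreq f ε x y) atTop = 0 := by
  have hbdd : IsBoundedUnder (· ≤ ·) atTop (closeFreq f ε x y) :=
    isBoundedUnder_of ⟨1, closeFreq_le_one⟩
  have hbdd' : IsBoundedUnder (· ≥ ·) atTop (closeFreq f ε x y) :=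
    isBoundedUnder_of ⟨0, closeFreq_nonneg⟩
  apply le_antisymm
  · refine le_of_forall_pos_le_add fun η hη => ?_
    refine liminf_le_of_frequently_le ((tendsto_block_end hp).frequently ?_) hbdd'
    refine (h.and_eventually ((tendsto_block_ratio hp M).eventually_lt_const hη)).mono ?_
    rintro n ⟨hn, hlt⟩
    refine (closeFreq_le (by positivity) fun i h1 h2 => hn i ⟨h1, h2⟩).trans ?_
    linarith
  · exact le_liminf_of_le hbdd.isCoboundedUnder_ge (Eventually.of_forall closeFreq_nonneg)

lemma liminf_edist_eq_zero (h : ∀ ε : ℝ, 0 < ε → ∃ᶠ i in atTop,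
      dist (iter f 0 i x) (iter f 0 i y) < ε) :
    liminf (fun n => edist (iter f 0 n x) (iter f 0 n y)) atTop = 0 := by
  refine le_antisymm (ENNReal.le_of_forall_pos_le_add fun η hη _ => ?_) zero_le
  rw [zero_add]
  refine liminf_le_of_frequently_le' ((h η hη).mono fun i hi => ?_)
  rw [edist_dist, ← ENNReal.ofReal_coe_nnreal]
  exact ENNReal.ofReal_le_ofReal hi.le

/-- Halving `δ` turns the frequent weak inequality into a strict one for the limsup. -/
lemma lt_limsup_edist {δ : ℝ} (hδ : 0 < δ) (h : ∃ᶠ i in atTop,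
      δ ≤ dist (iter f 0 i x) (iter f 0 i y)) :
    ENNReal.ofReal (δ / 2) <
      limsup (fun n => edist (iter f 0 n x) (iter f 0 n y)) atTop := by
  refine lt_of_lt_of_le ((ENNReal.ofReal_lt_ofReal_iff hδ).2 (half_lt_self hδ)) ?_
  refine le_limsup_of_frequently_le' (h.mono fun i hi => ?_)
  rw [edist_dist]
  exact ENNReal.ofReal_le_ofReal hi

end Frequency

/-! ### Switching sequences -/

/-- `selector c` is constant on each of the intervals `[2 ^ 2 ^ n, 2 ^ 2 ^ (n + 1))`. It takes each
of the values `false`, `c 0`, `c 1`, … on infinitely many of them. -/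
def selector (c : ℕ → Bool) (k : ℕ) : Bool :=
  Nat.casesOn (Nat.unpair (Nat.log 2 (Nat.log 2 k))).1 false c

lemma selector_eq (c : ℕ → Bool) {n k : ℕ} (h1 : 2 ^ 2 ^ n ≤ k) (h2 : k < 2 ^ 2 ^ (n + 1)) :
    selector c k = Nat.casesOn (Nat.unpair n).1 false c := by
  have hk : k ≠ 0 := (lt_of_lt_of_le (by positivity) h1).ne'
  have h3 : 2 ^ n ≤ Nat.log 2 k := Nat.le_log_of_pow_le one_lt_two h1
  have h4 : Nat.log 2 k < 2 ^ (n + 1) := Nat.log_lt_of_lt_pow hk h2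
  have h5 : Nat.log 2 (Nat.log 2 k) = n :=
    (Nat.log_eq_iff (Or.inr ⟨one_lt_two, (lt_of_lt_of_le (by positivity) h3).ne'⟩)).2 ⟨h3, h4⟩
  rw [selector, h5]

lemma frequently_unpair_fst_eq (j : ℕ) : ∃ᶠ n in atTop, (Nat.unpair n).1 = j :=
  Nat.frequently_atTop_iff_infinite.2 <| infinite_of_injective_forall_mem
    (f := fun q => Nat.pair j q) (fun q q' h => (Nat.pair_eq_pair.1 h).2) fun q => by simp

/-- Blocks with label `0` carry `false` in every selector; label `j + 1` below carries the `j`-th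
bit, where `c` and `c'` differ. -/
lemma frequently_selector_eq (c c' : ℕ → Bool) :
    ∃ᶠ n in atTop, ∀ k, 2 ^ 2 ^ n ≤ k → k < 2 ^ 2 ^ (n + 1) → selector c k = selector c' k :=
  (frequently_unpair_fst_eq 0).mono fun n hn k h1 h2 => by
    rw [selector_eq c h1 h2, selector_eq c' h1 h2, hn]
    rfl

lemma frequently_selector_ne {c c' : ℕ → Bool} (h : c ≠ c') :
    ∃ᶠ n in atTop, ∀ k, 2 ^ 2 ^ n ≤ k → k < 2 ^ 2 ^ (n + 1) → selector c k ≠ selector c' k := by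
  obtain ⟨j, hj⟩ := Function.ne_iff.1 h
  refine (frequently_unpair_fst_eq (j + 1)).mono fun n hn k h1 h2 => ?_
  rw [selector_eq c h1 h2, selector_eq c' h1 h2, hn]
  exact hj

/-- The quotient `(p * k + 1) / p` is left unevaluated, since it need not equal `k` when `p ≤ 1`. -/
lemma Subshift.weave_ne {N : ℕ} {A : Matrix (Fin N) (Fin N) ℕ} {p : ℕ} {u v : Subshift A}
    (h : ∀ k, u.1 (p * k) = v.1 (p * k)) (hne : ∀ k, u.1 (p * k + 1) ≠ v.1 (p * k + 1))
    {b b' : ℕ → Bool} {k : ℕ} (hk : b ((p * k + 1) / p) ≠ b' ((p * k + 1) / p)) :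
    (weave p u v h b).1 (p * k + 1) ≠ (weave p u v h b').1 (p * k + 1) := by
  change (if b ((p * k + 1) / p) then _ else _) ≠ if b' ((p * k + 1) / p) then _ else _
  have := hne k
  revert hk
  cases b ((p * k + 1) / p) <;> cases b' ((p * k + 1) / p) <;> simp [this, this.symm]

lemma uncountable_range_of_injective {Z : Type*} {x : (ℕ → Bool) → Z}
    (hx : Function.Injective x) : ¬ (range x).Countable := by
  intro h
  have := h.to_subtype
  have h1 := (Equiv.ofInjective x hx).countable_iff.2 this
  have h2 : Cardinal.mk (ℕ → Bool) = Cardinal.continuum := by simp [-Cardinal.mk_eq_aleph0, Cardinal.mk_nat]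
  exact Cardinal.aleph0_lt_continuum.not_ge (h2 ▸ Cardinal.mk_le_aleph0_iff.2 h1)

namespace IsCoding

variable {N : ℕ} {A : Matrix (Fin N) (Fin N) ℕ} {Z : Type*} [PseudoMetricSpace Z]
  {F : ℕ → Z → Z} {φ : ℕ → Subshift A → Z}

/-- A family of points any two of which are alternately close and apart on long blocks. -/
lemma exists_alternating_family (h : IsCoding F φ) (hA : IsTransitionMatrix A)
    (hirr : IsIrreducible A) (hbr : ∃ i₀, 2 ≤ ∑ j, A i₀ j) :
    ∃ (p M : ℕ) (δ : ℝ) (x : (ℕ → Bool) → Z), 0 < p ∧ 0 < δ ∧ Function.Injective x ∧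
      ∀ c c', c ≠ c' →
        (∀ ε : ℝ, 0 < ε → ∃ m, ∃ᶠ n in atTop, ∀ i ∈ block p m n,
          dist (iter F 0 i (x c)) (iter F 0 i (x c')) < ε) ∧
        ∃ᶠ n in atTop, ∀ i ∈ block p M n,
          δ ≤ dist (iter F 0 i (x c)) (iter F 0 i (x c')) := by
  obtain ⟨p, u, v, hp, huv, hne⟩ := Subshift.exists_loops hA hirr hbr
  obtain ⟨δ, hδ, hsep⟩ := h.separated (p + 2)
  let s : (ℕ → Bool) → Subshift A := fun c => Subshift.weave p u v huv (selector c)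
  have hfar : ∀ c c', c ≠ c' → ∃ᶠ n in atTop, ∀ i ∈ block p (p + 1) n,
      δ ≤ dist (iter F 0 i (φ 0 (s c))) (iter F 0 i (φ 0 (s c'))) := by
    intro c c' hcc
    refine (frequently_selector_ne hcc).mono fun n hn i hi => ?_
    by_contra! hlt
    rw [h.iter_apply, h.iter_apply, zero_add] at hlt
    -- `p * q` is the first multiple of `p` after `i`, and the loops differ one step later. That
    -- letter lies at most `p + 1` ahead of `i`, whence `separated (p + 2)` and blocks shortened by
    -- `p + 1`.
    set q := i / p + 1 with hq
    have hq1 : i < p * q := Nat.lt_mul_div_succ i hp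
    have hq2 : p * q ≤ i + p := by
      rw [hq, mul_add, mul_one]
      exact Nat.add_le_add_right (Nat.mul_div_le i p) p
    have := hsep i _ _ hlt (p * q + 1 - i) (by omega)
    rw [Subshift.iterate_shift_apply, Subshift.iterate_shift_apply,
      show i + (p * q + 1 - i) = p * q + 1 by omega] at this
    refine Subshift.weave_ne huv hne ?_ this
    have hdiv := div_mem_of_mem_block (j := p * q + 1) hp hi (by omega) (by omega)
    exact hn _ hdiv.1 hdiv.2
  refine ⟨p, p + 1, δ, fun c => φ 0 (s c), hp, hδ, ?_, fun c c' hcc => ⟨fun ε hε => ?_,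
    hfar c c' hcc⟩⟩
  -- Different parameters give orbits that are at some time at distance at least `δ`.
  · intro c c' heq
    by_contra hcc
    obtain ⟨i, hi⟩ := (frequently_of_block hp (hfar c c' hcc)).exists
    simp only at heq
    rw [heq, dist_self] at hi
    exact hδ.not_ge hi
  · obtain ⟨m, hm⟩ := h.close ε hε
    refine ⟨m, (frequently_selector_eq c c').mono fun n hn i hi => ?_⟩
    rw [h.iter_apply, h.iter_apply, zero_add]
    refine hm i _ _ fun k hk => ?_
    rw [Subshift.iterate_shift_apply, Subshift.iterate_shift_apply]
    have hdiv := div_mem_of_mem_block (j := i + k) hp hi (by omega) (by omega)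
    simp only [s, Subshift.weave, hn _ hdiv.1 hdiv.2]

lemma isStronglyLiYorkeChaotic [CompactSpace Z] (h : IsCoding F φ) (hA : IsTransitionMatrix A)
    (hirr : IsIrreducible A) (hbr : ∃ i₀, 2 ≤ ∑ j, A i₀ j) : IsStronglyLiYorkeChaotic F := by
  obtain ⟨p, M, δ, x, hp, hδ, hinj, hx⟩ := h.exists_alternating_family hA hirr hbr
  refine ⟨δ / 2, half_pos hδ, range x, uncountable_range_of_injective hinj, ?_,
    fun _ _ => Metric.isBounded_of_compactSpace⟩
  rintro _ ⟨c, rfl⟩ _ ⟨c', rfl⟩ hne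
  obtain ⟨h1, h2⟩ := hx c c' (ne_of_apply_ne x hne)
  refine ⟨liminf_edist_eq_zero fun ε hε => ?_, lt_limsup_edist hδ (frequently_of_block hp h2)⟩
  obtain ⟨m, hm⟩ := h1 ε hε
  exact frequently_of_block hp hm

lemma isDistributionallyChaotic (h : IsCoding F φ) (hA : IsTransitionMatrix A)
    (hirr : IsIrreducible A) (hbr : ∃ i₀, 2 ≤ ∑ j, A i₀ j) : IsDistributionallyChaotic F := by
  obtain ⟨p, M, δ, x, hp, hδ, hinj, hx⟩ := h.exists_alternating_family hA hirr hbr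
  refine ⟨range x, uncountable_range_of_injective hinj, ?_⟩
  rintro _ ⟨c, rfl⟩ _ ⟨c', rfl⟩ hne
  obtain ⟨h1, h2⟩ := hx c c' (ne_of_apply_ne x hne)
  refine ⟨fun ε hε => ?_, δ, hδ, liminf_closeFreq_eq_zero hp h2⟩
  obtain ⟨m, hm⟩ := h1 ε hε
  exact limsup_closeFreq_eq_one hp hm

end IsCoding

end NDS

/-! ### Cylinders: construction of the coding. -/

namespace NDS

section Cylinders

variable {X : Type*} {N : ℕ} {A : Matrix (Fin N) (Fin N) ℕ} {f : ℕ → X → X}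
  {V : Fin N → ℕ → Set X}

lemma iter_succ_apply' (f : ℕ → X → X) (n k : ℕ) (x : X) :
    iter f (n + 1) k (f n x) = iter f n (k + 1) x := by
  induction k with
  | zero => rfl
  | succ k ih =>
    change f (n + 1 + k) (iter f (n + 1) k (f n x)) = f (n + (k + 1)) (iter f n (k + 1) x)
    rw [ih, show n + 1 + k = n + (k + 1) by omega]

lemma mem_cyl {α : Subshift A} {m n : ℕ} {x : X} :
    x ∈ cyl f V α m n ↔ ∀ k ≤ m, iter f n k x ∈ V (α.1 k) (n + k) := by
  simp [cyl]

lemma mem_cyl_zero {α : Subshift A} {n : ℕ} {x : X} :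
    x ∈ cyl f V α 0 n ↔ x ∈ V (α.1 0) n := by
  simp [mem_cyl, iter]

lemma mem_cyl_succ {α : Subshift A} {m n : ℕ} {x : X} :
    x ∈ cyl f V α (m + 1) n ↔ x ∈ V (α.1 0) n ∧ f n x ∈ cyl f V α.shift m (n + 1) := by
  simp only [mem_cyl, iter_succ_apply']
  constructor
  · intro h
    refine ⟨h 0 (Nat.zero_le _), fun k hk => ?_⟩
    have := h (k + 1) (by omega)
    rwa [show n + 1 + k = n + (k + 1) by omega]
  · rintro ⟨h0, h⟩ k hk
    cases k with
    | zero => exact h0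
    | succ k =>
      have := h k (by omega)
      rwa [show n + 1 + k = n + (k + 1) by omega] at this

lemma cyl_anti (α : Subshift A) (n : ℕ) : Antitone fun m => cyl f V α m n :=
  fun _ _ hm _ hx => mem_cyl.2 fun k hk => mem_cyl.1 hx k (hk.trans hm)

lemma cyl_subset_of_eq {α β : Subshift A} {m : ℕ} (h : ∀ k ≤ m, α.1 k = β.1 k) (n : ℕ) :
    cyl f V α m n ⊆ cyl f V β m n :=
  fun _ hx => mem_cyl.2 fun k hk => h k hk ▸ mem_cyl.1 hx k hk

/-- A point of the cylinder of the shifted code lies in `V (α.1 1) (n + 1)`, hence has a preimage in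
`V (α.1 0) n`. -/
lemma IsWeaklyCoupledExpanding.hypNonempty [TopologicalSpace X]
    (h : IsWeaklyCoupledExpanding A f V) : HypNonempty A f V := by
  intro α m
  induction m generalizing α with
  | zero => exact fun n => (h.1 (α.1 0) n).imp fun x hx => mem_cyl_zero.2 hx
  | succ m ih =>
    intro n
    obtain ⟨y, hy⟩ := ih α.shift (n + 1)
    have hy0 : y ∈ V (α.1 1) (n + 1) :=
      mem_cyl_zero.1 (cyl_anti α.shift (n + 1) (Nat.zero_le m) hy)
    obtain ⟨x, hx, rfl⟩ := h.2.2 (α.1 0) n (mem_iUnion₂.2 ⟨α.1 1, α.2 0, hy0⟩)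
    exact ⟨x, mem_cyl_succ.2 ⟨hx, hy⟩⟩

/-- Two points of a cylinder are separated by the factor `c` at each of `m` steps, yet never beyond
the diameter of `X`. -/
lemma pow_mul_dist_le_of_mem_cyl [PseudoMetricSpace X] [CompactSpace X] {c : ℝ} (hc : 0 ≤ c)
    (h : ∀ i n, ∀ x ∈ V i n, ∀ y ∈ V i n, c * dist x y ≤ dist (f n x) (f n y)) (m : ℕ) :
    ∀ (α : Subshift A) (n : ℕ), ∀ x ∈ cyl f V α m n, ∀ y ∈ cyl f V α m n,
      c ^ m * dist x y ≤ Metric.diam (univ : Set X) := by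
  induction m with
  | zero =>
    intro α n x _ y _
    rw [pow_zero, one_mul]
    exact Metric.dist_le_diam_of_mem isCompact_univ.isBounded (mem_univ x) (mem_univ y)
  | succ m ih =>
    intro α n x hx y hy
    rw [mem_cyl_succ] at hx hy
    rw [pow_succ, mul_assoc]
    exact (mul_le_mul_of_nonneg_left (h _ n x hx.1 y hy.1) (pow_nonneg hc m)).trans
      (ih _ _ _ hx.2 _ hy.2)

lemma IsUniformlyExpanding.hypShrinking [PseudoMetricSpace X] [CompactSpace X]
    (h : IsUniformlyExpanding f V) : HypShrinking A f V := by
  obtain ⟨c, hc, h⟩ := h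
  have hc0 : 0 < c := one_pos.trans hc
  intro α
  rw [Metric.tendstoUniformly_iff]
  intro ε hε
  have ht : Tendsto (fun m : ℕ => Metric.diam (univ : Set X) * (c⁻¹) ^ m) atTop (𝓝 0) := by
    simpa using (tendsto_pow_atTop_nhds_zero_of_lt_one (inv_nonneg.2 hc0.le)
      (inv_lt_one_of_one_lt₀ hc)).const_mul (Metric.diam (univ : Set X))
  filter_upwards [ht.eventually_lt_const hε] with m hm n
  rw [dist_comm, Real.dist_0_eq_abs, abs_of_nonneg Metric.diam_nonneg]
  refine lt_of_le_of_lt (Metric.diam_le_of_forall_dist_le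
    (mul_nonneg Metric.diam_nonneg (by positivity)) fun x hx y hy => ?_) hm
  rw [inv_pow, ← div_eq_mul_inv, le_div_iff₀ (pow_pos hc0 m), mul_comm]
  exact pow_mul_dist_le_of_mem_cyl hc0.le h m α n x hx y hy

lemma continuous_iter [TopologicalSpace X] (hf : ∀ n, Continuous (f n)) (n k : ℕ) :
    Continuous (iter f n k) := by
  induction k with
  | zero => exact continuous_id
  | succ k ih => exact (hf _).comp ih

lemma isClosed_cyl [TopologicalSpace X] (hf : ∀ n, Continuous (f n))
    (hV : ∀ i n, IsClosed (V i n)) (α : Subshift A) (m n : ℕ) : IsClosed (cyl f V α m n) :=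
  isClosed_iInter fun k => isClosed_iInter fun _ => (hV _ _).preimage (continuous_iter hf n k)

/-- The shrinking of the cylinders is uniform in the code. -/
lemma HypShrinking.exists_diam_lt [PseudoMetricSpace X] [CompactSpace X]
    (h : HypShrinking A f V) {ε : ℝ} (hε : 0 < ε) :
    ∃ m, ∀ (α : Subshift A) (n : ℕ), Metric.diam (cyl f V α m n) < ε := by
  have h1 : ∀ α : Subshift A, ∃ m, ∀ n, Metric.diam (cyl f V α m n) < ε := fun α => by
    obtain ⟨m, hm⟩ := (Metric.tendstoUniformly_iff.1 (h α) ε hε).exists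
    refine ⟨m, fun n => ?_⟩
    have := hm n
    rwa [dist_comm, Real.dist_0_eq_abs, abs_of_nonneg Metric.diam_nonneg] at this
  choose r hr using h1
  let K := {s : ℕ → Fin N | ∀ j, A (s j) (s (j + 1)) = 1}
  -- A cylinder of depth `r` depends on the letters `0, …, r` only, so the bound for one code holds
  -- for all codes near it. Finitely many such neighbourhoods suffice, and the largest depth works
  -- for all.
  obtain ⟨t, ht⟩ := (Subshift.isCompact_admissible A).elim_nhds_subcover'
    (fun s hs => {t | ∀ k < r ⟨s, hs⟩ + 1, t k = s k})
    fun s hs => Subshift.eventually_eq_of_lt s _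
  refine ⟨t.sup fun s => r ⟨s.1, s.2⟩, fun α n => ?_⟩
  obtain ⟨s, hs, hα⟩ := mem_iUnion₂.1 (ht α.2)
  refine lt_of_le_of_lt (Metric.diam_mono ?_ (Metric.isBounded_of_compactSpace))
    (hr ⟨s.1, s.2⟩ n)
  exact (cyl_anti α n (Finset.le_sup (f := fun s : K => r ⟨s.1, s.2⟩) hs)).trans
    (cyl_subset_of_eq (fun k hk => hα k (Nat.lt_succ_of_le hk)) n)

lemma exists_forall_iter_lt [PseudoMetricSpace X] (hf : UniformEquicontinuous f) (k : ℕ) {ε : ℝ}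
    (hε : 0 < ε) : ∃ δ > 0, ∀ n x y, dist x y < δ → dist (iter f n k x) (iter f n k y) < ε := by
  induction k generalizing ε with
  | zero => exact ⟨ε, hε, fun _ _ _ h => h⟩
  | succ k ih =>
    obtain ⟨η, hη, h1⟩ := Metric.uniformEquicontinuous_iff.1 hf ε hε
    obtain ⟨δ, hδ, h2⟩ := ih hη
    exact ⟨δ, hδ, fun n x y hxy => h1 _ _ (h2 n x y hxy) _⟩

lemma exists_pos_le_dist_of_disjoint [PseudoMetricSpace X] [CompactSpace X] {W : Fin N → Set X}
    (hW : ∀ i, IsClosed (W i)) (hd : ∀ i j, i ≠ j → Disjoint (W i) (W j)) :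
    ∃ δ > 0, ∀ i j, ∀ x ∈ W i, ∀ y ∈ W j, dist x y < δ → i = j := by
  have h : ∀ q : Fin N × Fin N, ∀ᶠ δ : ℝ in 𝓝[>] 0,
      ∀ x ∈ W q.1, ∀ y ∈ W q.2, dist x y < δ → q.1 = q.2 := by
    rintro ⟨i, j⟩
    by_cases hij : i = j
    · exact Eventually.of_forall fun _ _ _ _ _ _ => hij
    obtain ⟨r, hr, h⟩ := Metric.exists_pos_forall_lt_edist (hW i).isCompact (hW j) (hd i j hij)
    have hr' : (0 : ℝ) < r := hr
    filter_upwards [Ioo_mem_nhdsGT hr'] with δ hδ x hx y hy hxy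
    have h1 := h x hx y hy
    rw [edist_nndist, ENNReal.coe_lt_coe] at h1
    have h2 : (r : ℝ) < dist x y := h1
    exact absurd (hxy.trans hδ.2) h2.not_gt
  obtain ⟨δ, hδ, hpos⟩ := ((eventually_all.2 h).and self_mem_nhdsWithin).exists
  exact ⟨δ, hpos, fun i j => hδ (i, j)⟩

/-- The points whose itineraries are given by the codes. -/
lemma exists_isCoding [MetricSpace X] [CompactSpace X] (hf : ∀ n, Continuous (f n))
    (hequi : UniformEquicontinuous f) (hVcl : ∀ i n, IsClosed (V i n)) {W : Fin N → Set X}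
    (hWcl : ∀ i, IsClosed (W i)) (hWdisj : ∀ i j, i ≠ j → Disjoint (W i) (W j))
    (hVW : ∀ i n, V i n ⊆ W i) (hne : HypNonempty A f V) (hsh : HypShrinking A f V) :
    ∃ g : ℕ → Subshift A → X, IsCoding f g ∧ ∀ n α, g n α ∈ V (α.1 0) n := by
  have hex : ∀ n (α : Subshift A), ∃ x, ∀ m, x ∈ cyl f V α m n := fun n α => by
    obtain ⟨x, hx⟩ := IsCompact.nonempty_iInter_of_sequence_nonempty_isCompact_isClosed
      (fun m => cyl f V α m n) (fun m => cyl_anti α n m.le_succ) (fun m => hne α m n)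
      (isClosed_cyl hf hVcl α 0 n).isCompact (fun m => isClosed_cyl hf hVcl α m n)
    exact ⟨x, mem_iInter.1 hx⟩
  choose g hg using hex
  have hclose : ∀ ε : ℝ, 0 < ε → ∃ m, ∀ n (α : Subshift A), ∀ x ∈ cyl f V α m n,
      ∀ y ∈ cyl f V α m n, dist x y < ε := by
    intro ε hε
    obtain ⟨m, hm⟩ := hsh.exists_diam_lt hε
    exact ⟨m, fun n α x hx y hy => lt_of_le_of_lt
      (Metric.dist_le_diam_of_mem Metric.isBounded_of_compactSpace hx hy) (hm α n)⟩
  refine ⟨g, ⟨fun n α => ?_, fun ε hε => ?_, fun m => ?_⟩, fun n α => mem_cyl_zero.1 (hg n α 0)⟩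
  -- Both points lie in every cylinder of `α.shift` at time `n + 1`, and these shrink.
  · refine eq_of_forall_dist_le fun ε hε => ?_
    obtain ⟨m, hm⟩ := hclose ε hε
    exact (hm (n + 1) α.shift _ (mem_cyl_succ.1 (hg n α (m + 1))).2 _ (hg _ _ m)).le
  · obtain ⟨m, hm⟩ := hclose ε hε
    refine ⟨m + 1, fun n α β h => hm n β _ ?_ _ (hg n β m)⟩
    exact cyl_subset_of_eq (fun k hk => h k (Nat.lt_succ_of_le hk)) n (hg n α m)
  -- The letter at position `m` is the index of the piece `W i` containing the `m`-th iterate.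
  -- Nearby points have nearby iterates, uniformly in `n` by equi-continuity, and pieces with
  -- different indices are at least `η` apart.
  · obtain ⟨η, hη, hW⟩ := exists_pos_le_dist_of_disjoint hWcl hWdisj
    induction m with
    | zero => exact ⟨1, one_pos, by simp⟩
    | succ m ih =>
      obtain ⟨δ, hδ, h1⟩ := ih
      obtain ⟨δ', hδ', h2⟩ := exists_forall_iter_lt hequi m hη
      refine ⟨min δ δ', lt_min hδ hδ', fun n α β h k hk => ?_⟩
      rcases (Nat.lt_succ_iff_lt_or_eq.1 hk) with hk | rfl
      · exact h1 n α β (h.trans_le (min_le_left _ _)) k hk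
      · exact hW _ _ _ (hVW _ _ (mem_cyl.1 (hg n α k) k le_rfl)) _
          (hVW _ _ (mem_cyl.1 (hg n β k) k le_rfl)) (h2 n _ _ (h.trans_le (min_le_right _ _)))

open TopologicalSpace in
lemma IsCoding.singleton [MetricSpace X] {g : ℕ → Subshift A → X} (h : IsCoding f g)
    (hf : ∀ n, Continuous (f n)) :
    IsCoding (induced f hf) fun n α => ({g n α} : NonemptyCompacts X) := by
  have hd : ∀ x y : X, dist ({x} : NonemptyCompacts X) {y} = dist x y :=
    NonemptyCompacts.isometry_singleton.dist_eq
  refine ⟨fun n α => ?_, ?_, ?_⟩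
  · rw [← h.semiconj]
    exact NonemptyCompacts.map_singleton (hf n) (g n α)
  · simpa only [hd] using h.close
  · simpa only [hd] using h.separated

end Cylinders

end NDS

theorem theorem4p7 {X : Type*} [MetricSpace X] [CompactSpace X] {N : ℕ}
    (A : Matrix (Fin N) (Fin N) ℕ) (hA : NDS.IsTransitionMatrix A)
    (f : ℕ → X → X) (hf : ∀ n, Continuous (f n)) (hequi : UniformEquicontinuous f)
    (V : Fin N → ℕ → Set X) (hVne : ∀ i n, (V i n).Nonempty) (hVcl : ∀ i n, IsClosed (V i n))
    (W : Fin N → Set X) (hWcl : ∀ i, IsClosed (W i))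
    (hWdisj : ∀ i j, i ≠ j → Disjoint (W i) (W j)) (hVW : ∀ i n, V i n ⊆ W i)
    (hyp : (NDS.HypNonempty A f V ∧ NDS.HypShrinking A f V) ∨
      (NDS.IsWeaklyCoupledExpanding A f V ∧ NDS.IsUniformlyExpanding f V)) :
    (∃ C : ℕ → Set (TopologicalSpace.NonemptyCompacts X),
      (∀ n, (C n).Nonempty ∧ IsCompact (C n) ∧ C n ⊆ (⋃ i, NDS.hyper (V i n)) ∧
        NDS.induced f hf n '' C n = C (n + 1)) ∧
      NDS.IsEquiConjugate (NDS.induced f hf) C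
        (fun _ => (NDS.Subshift.shift : NDS.Subshift A → NDS.Subshift A)) (fun _ => Set.univ) ∧
      Filter.Tendsto (NDS.growth A) Filter.atTop (nhds (NDS.rho A)) ∧ 0 < NDS.rho A ∧
      NDS.entropy (NDS.induced f hf) (C 0) = (Real.log (NDS.rho A) : EReal)) ∧
    (NDS.IsIrreducible A → (∃ i₀, 2 ≤ ∑ j, A i₀ j) →
      NDS.IsStronglyLiYorkeChaotic (NDS.induced f hf) ∧
      NDS.IsDistributionallyChaotic (NDS.induced f hf)) := by

  obtain ⟨hne, hsh⟩ : NDS.HypNonempty A f V ∧ NDS.HypShrinking A f V :=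
    hyp.elim id fun h => ⟨h.1.hypNonempty, h.2.hypShrinking⟩
  obtain ⟨g, hg, hgV⟩ :=
    NDS.exists_isCoding hf hequi hVcl hWcl hWdisj hVW hne hsh
  have hc := hg.singleton hf
  have := NDS.Subshift.nonempty hA
  refine ⟨⟨_, fun n => ⟨range_nonempty _, hc.isCompact_range n, ?_, hc.image_range hA n⟩,
    hc.isEquiConjugate, NDS.Subshift.tendsto_growth hA, NDS.Subshift.rho_pos hA,
    hc.entropy_eq hA⟩, fun hirr hbr => ⟨hc.isStronglyLiYorkeChaotic hA hirr hbr,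
    hc.isDistributionallyChaotic hA hirr hbr⟩⟩
  rintro _ ⟨α, rfl⟩
  exact mem_iUnion.2 ⟨α.1 0, singleton_subset_iff.2 (hgV n α)⟩
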